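/- Let $W=(w_{ij})_{i,j\ge 1}$ be a random matrix with independent entries, where $w_{ij}$ is geometric with parameter $q_j\in(0,1)$, i.e. $\mathrm{Prob}(w_{ij}=k)=(1-q_j)\,q_j^k$ for $k=0,1,2,\ldots$. For $m,n\ge 1$ define the last-passage time $$G(m,n)=\max_{\Pi:(1,1)\to(m,n)}\ \sum_{(i,j)\in\Pi} w_{ij},$$ where the maximum is over directed lattice paths $\Pi$ from $(1,1)$ to $(m,n)$, i.e. paths that use only steps $(i,j)\to(i+1,j)$ and $(i,j)\to(i,j+1)$. Then for all $m,n\ge 1$ the joint law of the random vector $(G(m,n),G(m-1,n),\ldots,G(1,n))$ is invariant under permutations of the parameters $(q_1,\ldots,q_n)$: if $\sigma$ is a permutation of $\{1,\ldots,n\}$ and $W'$ is a random matrix of the same kind with the parameters $(q_{\sigma(1)},\ldots,q_{\sigma(n)})$ in the first $n$ columns and $q_j$ in column $j$ for $j>n$, with last-passage times $G'$, then $(G(m,n),\ldots,G(1,n))$ and $(G'(m,n),\ldots,G'(1,n))$ have the same distribution; that is, $$\mathrm{Prob}(G(m,n)=\lambda_1,\ldots,G(1,n)=\lambda_m)=\mathrm{Prob}(G'(m,n)=\lambda_1,\ldots,G'(1,n)=\lambda_m)$$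 for all $(\lambda_1,\ldots,\lambda_m)\in\mathbb{N}^m$. -/

import Mathlib

open MeasureTheory ProbabilityTheory

namespace LastPassage

/-- A directed step: `(i, j) → (i + 1, j)` or `(i, j) → (i, j + 1)`. -/
def Step (p r : ℕ × ℕ) : Prop :=
  r = (p.1 + 1, p.2) ∨ r = (p.1, p.2 + 1)

/-- `P` is the list of successive vertices of a directed path from `a` to `b`. -/
structure IsDirectedPath (a b : ℕ × ℕ) (P : List (ℕ × ℕ)) : Prop where
  chain : P.IsChain Step
  head : P.head? = some a
  last : P.getLast? = some b

/-- The sum of the weights `w i j` over the vertices `(i, j)` of a path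
(the vertices of a directed path are pairwise distinct). -/
def pathWeight (w : ℕ → ℕ → ℕ) (P : List (ℕ × ℕ)) : ℕ :=
  (P.map fun p => w p.1 p.2).sum

/-- The weights of all directed paths from `(1, 1)` to `(m, n)`. -/
def pathWeights (w : ℕ → ℕ → ℕ) (m n : ℕ) : Set ℕ :=
  {s | ∃ P : List (ℕ × ℕ), IsDirectedPath (1, 1) (m, n) P ∧ pathWeight w P = s}

/-- The last-passage time `G(m, n)`: the maximal weight of a directed path from `(1, 1)` to
`(m, n)`. For `m, n ≥ 1` the supremum is a maximum, see `isGreatest_lastPassage`. -/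
noncomputable def lastPassage (w : ℕ → ℕ → ℕ) (m n : ℕ) : ℕ :=
  sSup (pathWeights w m n)

theorem IsDirectedPath.add_le {b : ℕ × ℕ} : ∀ {P : List (ℕ × ℕ)} {a : ℕ × ℕ},
    IsDirectedPath a b P → a.1 + a.2 ≤ b.1 + b.2
  | [], _, h => by simpa using h.head
  | [c], a, h => by
    have h1 : c = a := by simpa using h.head
    have h2 : c = b := by simpa using h.last
    rw [← h1, ← h2]
  | c :: d :: l, a, h => by
    have h1 : c = a := by simpa using h.head
    have hc := List.isChain_cons_cons.1 h.chain
    have h3 : IsDirectedPath d b (d :: l) := ⟨hc.2, rfl, by simpa using h.last⟩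
    have := h3.add_le
    subst h1
    rcases hc.1 with rfl | rfl <;> simp only at this <;> omega

theorem exists_pathWeight_le (w : ℕ → ℕ → ℕ) (b : ℕ × ℕ) : ∀ (d : ℕ) (a : ℕ × ℕ),
    b.1 + b.2 < a.1 + a.2 + d → ∃ B, ∀ P, IsDirectedPath a b P → pathWeight w P ≤ B
  | 0, a, hd => ⟨0, fun P hP => by have := hP.add_le; omega⟩
  | d + 1, a, hd => by
    obtain ⟨B₁, h₁⟩ := exists_pathWeight_le w b d (a.1 + 1, a.2) (by simp only; omega)
    obtain ⟨B₂, h₂⟩ := exists_pathWeight_le w b d (a.1, a.2 + 1) (by simp only; omega)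
    refine ⟨w a.1 a.2 + (B₁ + B₂), fun P hP => ?_⟩
    match P, hP with
    | [], hP => simp [pathWeight]
    | [c], hP =>
      have h1 : c = a := by simpa using hP.head
      simp [pathWeight, h1]
    | c :: e :: l, hP =>
      have h1 : c = a := by simpa using hP.head
      subst h1
      have hc := List.isChain_cons_cons.1 hP.chain
      have h3 : IsDirectedPath e b (e :: l) := ⟨hc.2, rfl, by simpa using hP.last⟩
      have h4 : pathWeight w (c :: e :: l) = w c.1 c.2 + pathWeight w (e :: l) := by
        simp [pathWeight]
      rcases hc.1 with rfl | rfl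
      · have := h₁ _ h3
        omega
      · have := h₂ _ h3
        omega

theorem exists_isDirectedPath : ∀ (x y : ℕ) (a : ℕ × ℕ),
    ∃ P, IsDirectedPath a (a.1 + x, a.2 + y) P
  | 0, 0, a => ⟨[a], by simp, by simp, by simp⟩
  | x + 1, y, a => by
    obtain ⟨P, hP⟩ := exists_isDirectedPath x y (a.1 + 1, a.2)
    match P, hP with
    | [], hP => simpa using hP.head
    | c :: l, hP =>
      have h1 : c = (a.1 + 1, a.2) := by simpa using hP.head
      refine ⟨a :: c :: l, List.isChain_cons_cons.2 ⟨Or.inl h1, hP.chain⟩, rfl, ?_⟩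
      have := hP.last
      simp only [List.getLast?_cons_cons, this]
      congr 2
      omega
  | 0, y + 1, a => by
    obtain ⟨P, hP⟩ := exists_isDirectedPath 0 y (a.1, a.2 + 1)
    match P, hP with
    | [], hP => simpa using hP.head
    | c :: l, hP =>
      have h1 : c = (a.1, a.2 + 1) := by simpa using hP.head
      refine ⟨a :: c :: l, List.isChain_cons_cons.2 ⟨Or.inr h1, hP.chain⟩, rfl, ?_⟩
      have := hP.last
      simp only [List.getLast?_cons_cons, this]
      congr 2
      omega

theorem isGreatest_lastPassage (w : ℕ → ℕ → ℕ) {m n : ℕ} (hm : 1 ≤ m) (hn : 1 ≤ n) :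
    IsGreatest (pathWeights w m n) (lastPassage w m n) := by
  have hne : (pathWeights w m n).Nonempty := by
    obtain ⟨P, hP⟩ := exists_isDirectedPath (m - 1) (n - 1) (1, 1)
    refine ⟨_, P, ?_, rfl⟩
    simpa [Nat.add_sub_cancel' hm, Nat.add_sub_cancel' hn] using hP
  have hbd : BddAbove (pathWeights w m n) := by
    obtain ⟨B, hB⟩ := exists_pathWeight_le w (m, n) (m + n + 1) (1, 1) (by simp only; omega)
    refine ⟨B, ?_⟩
    rintro s ⟨P, hP, rfl⟩
    exact hB P hP
  exact ⟨Nat.sSup_mem hne hbd, fun s hs => le_csSup hbd hs⟩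

/-- `W = (W i j)_{i, j ≥ 1}` is a random matrix on the probability space `(Ω, μ)` with independent
entries in `ℕ`, and `W i j` is geometric with parameter `q j`:
`Prob(W i j = k) = (1 - q j) * (q j) ^ k`. Nothing is required of entries with `i = 0` or `j = 0`;
they are not visited by paths that start at `(1, 1)`. -/
structure IsGeometricMatrix {Ω : Type*} [MeasurableSpace Ω] (μ : Measure Ω) (q : ℕ → ℝ)
    (W : ℕ → ℕ → Ω → ℕ) : Prop where
  measurable : ∀ i j, 1 ≤ i → 1 ≤ j → Measurable (W i j)
  indep : iIndepFun (fun (p : {p : ℕ × ℕ // 1 ≤ p.1 ∧ 1 ≤ p.2}) => W p.1.1 p.1.2) μ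
  law : ∀ i j, 1 ≤ i → 1 ≤ j → ∀ k : ℕ,
    μ {ω | W i j ω = k} = ENNReal.ofReal ((1 - q j) * q j ^ k)

/-- The random vector `(G(m, n), G(m - 1, n), …, G(1, n))` of the random matrix `W`;
its entry at position `k = 0, …, m - 1` is `G(m - k, n)`. -/
noncomputable def columnVector {Ω : Type*} (W : ℕ → ℕ → Ω → ℕ) (m n : ℕ) (ω : Ω) : Fin m → ℕ :=
  fun k => lastPassage (fun i j => W i j ω) (m - k) n

end LastPassage

namespace LastPassage

/-! The columns `(G(1,j), …, G(m,j))` form a Markov chain in `j`, started from the zero vector,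
whose `j`-th transition kernel depends only on `q j`. It therefore suffices that the kernels for two
parameters `p` and `q` commute (`columnLaw_comm`); the law after `n` columns is then independent of
their order.

For commutation let `p < q` and `r = p / q`. Two columns are run down together, row by row, and only
the second is recorded. Swapping `p` and `q` is compensated by replacing the first-column value `b`
by `max b (c - g)`, where `c` is the second-column value and `g` is an independent geometric
variable of parameter `r` (`twoColumnLaw_intertwine`). This form survives each row thanks to the
measure-preserving bijection `exchange`. At the top `b = c = 0`, so `g` has no effect. -/

/-- The geometric distribution `k ↦ (1 - q) * q ^ k`. -/
noncomputable def geometric (q : Set.Ioo (0 : ℝ) 1) : PMF ℕ :=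
  ⟨fun k => ENNReal.ofReal ((1 - q) * (q : ℝ) ^ k), by
    have h1 : (0 : ℝ) ≤ 1 - q := sub_nonneg.2 q.2.2.le
    have h := (hasSum_geometric_of_lt_one q.2.1.le q.2.2).mul_left (1 - (q : ℝ))
    rw [mul_inv_cancel₀ (sub_pos.2 q.2.2).ne'] at h
    rw [ENNReal.summable.hasSum_iff, ← ENNReal.ofReal_tsum_of_nonneg
      (fun k => mul_nonneg h1 (pow_nonneg q.2.1.le k)) h.summable, h.tsum_eq, ENNReal.ofReal_one]⟩

theorem geometric_apply (q : Set.Ioo (0 : ℝ) 1) (k : ℕ) :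
    geometric q k = ENNReal.ofReal ((1 - q) * (q : ℝ) ^ k) := rfl

/-! ### The exchange bijection for geometric variables -/

/-- A bijection of `ℕ³` that interchanges the roles of the first two coordinates. -/
def exchange : ℕ × ℕ × ℕ ≃ ℕ × ℕ × ℕ where
  toFun x := (x.1 + (x.2.1 - x.2.2), min x.2.1 x.2.2, x.1 + (x.2.2 - x.2.1))
  invFun y := (min y.1 y.2.2, y.2.1 + (y.1 - y.2.2), y.2.1 + (y.2.2 - y.1))
  left_inv x := by ext <;> simp only <;> omega
  right_inv x := by ext <;> simp only <;> omega

/-- Three independent geometric variables. -/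
noncomputable def geometricTriple (p q r : Set.Ioo (0 : ℝ) 1) : PMF (ℕ × ℕ × ℕ) :=
  (geometric p).bind fun u => (geometric q).bind fun v => (geometric r).map fun g => (u, v, g)

theorem geometricTriple_apply (p q r : Set.Ioo (0 : ℝ) 1) (u v g : ℕ) :
    geometricTriple p q r (u, v, g) = geometric p u * (geometric q v * geometric r g) := by
  simp only [geometricTriple, PMF.bind_apply, PMF.map_apply, Prod.mk.injEq]
  rw [tsum_eq_single u, tsum_eq_single v, tsum_eq_single g]
  · simp
  · intro g' h; simp [h.symm]
  · intro v' h; simp [h.symm]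
  · intro u' h; simp [h.symm]

/-- With `p = q * r`, the weight `p^u q^v r^g` equals `q^(u+v) r^(u+g)`. The bijection sends these
exponents to the corresponding ones with first and second coordinates in the same roles: `u' + v' =
u + v` and `v' + g' = u + g`. The normalising constants agree. -/
theorem geometricTriple_map_exchange {p q r : Set.Ioo (0 : ℝ) 1} (h : (p : ℝ) = q * r) :
    (geometricTriple p q r).map exchange = geometricTriple q p r := by
  ext y
  obtain ⟨⟨u, v, g⟩, rfl⟩ := exchange.surjective y
  rw [PMF.map_apply, tsum_eq_single (u, v, g)]
  · rw [if_pos rfl, geometricTriple_apply]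
    change _ = geometricTriple q p r (u + (v - g), min v g, u + (g - v))
    rw [geometricTriple_apply]
    have key : ∀ s : Set.Ioo (0 : ℝ) 1, 0 ≤ 1 - (s : ℝ) := fun s => sub_nonneg.2 s.2.2.le
    have key' : ∀ (s : Set.Ioo (0 : ℝ) 1) (k : ℕ), 0 ≤ (1 - (s : ℝ)) * (s : ℝ) ^ k :=
      fun s k => mul_nonneg (key s) (pow_nonneg s.2.1.le k)
    simp only [geometric_apply]
    rw [← ENNReal.ofReal_mul (key' _ _), ← ENNReal.ofReal_mul (key' _ _),
      ← ENNReal.ofReal_mul (key' _ _), ← ENNReal.ofReal_mul (key' _ _)]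
    congr 1
    rcases le_total v g with hvg | hvg <;> obtain ⟨d, rfl⟩ := Nat.exists_eq_add_of_le hvg
    · simp only [Nat.sub_eq_zero_of_le hvg, min_eq_left hvg, Nat.add_sub_cancel_left, add_zero,
        pow_add]
      rw [h]; ring
    · simp only [Nat.sub_eq_zero_of_le hvg, min_eq_right hvg, Nat.add_sub_cancel_left, add_zero,
        pow_add]
      rw [h]; ring
  · intro x hx
    rw [if_neg fun e => hx (exchange.injective e.symm)]

/-- A function of three independent geometric variables, rewritten through `exchange`. -/
theorem bind_exchange {α : Type*} {p q r : Set.Ioo (0 : ℝ) 1} (h : (p : ℝ) = q * r)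
    (F : ℕ → ℕ → ℕ → PMF α) :
    ((geometric p).bind fun u => (geometric q).bind fun v => (geometric r).bind fun g =>
      F (u + (v - g)) (min v g) (u + (g - v))) =
    (geometric r).bind fun g => (geometric q).bind fun u => (geometric p).bind fun v =>
      F u v g := by
  have h1 := congrArg (fun P => P.bind fun x => F x.1 x.2.1 x.2.2) (geometricTriple_map_exchange h)
  simp only [geometricTriple, PMF.map, PMF.bind_bind, PMF.pure_bind, Function.comp_apply,
    exchange, Equiv.coe_fn_mk] at h1
  rw [h1]
  conv_rhs => rw [PMF.bind_comm]
  congr 1; funext u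
  rw [PMF.bind_comm]

/-! ### Commutation of the column kernels -/

/-- The law of the passage times in a column with parameter `q`, given the passage times `as` of
the preceding column; `b` is the passage time above the first entry. -/
noncomputable def columnLaw (q : Set.Ioo (0 : ℝ) 1) : List ℕ → ℕ → PMF (List ℕ)
  | [], _ => PMF.pure []
  | a :: as, b => (geometric q).bind fun u =>
      (columnLaw q as (max b a + u)).map (List.cons (max b a + u))

/-- The law of the second of two successive columns, with parameters `p` and `q`. -/
noncomputable def twoColumnLaw (p q : Set.Ioo (0 : ℝ) 1) : List ℕ → ℕ → ℕ → PMF (List ℕ)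
  | [], _, _ => PMF.pure []
  | a :: as, b, c => (geometric p).bind fun u => (geometric q).bind fun v =>
      (twoColumnLaw p q as (max b a + u) (max c (max b a + u) + v)).map
        (List.cons (max c (max b a + u) + v))

/-- Sampling column by column or row by row is the same, since the weights are independent. -/
theorem columnLaw_bind_columnLaw (p q : Set.Ioo (0 : ℝ) 1) (as : List ℕ) (b c : ℕ) :
    ((columnLaw p as b).bind fun bs => columnLaw q bs c) = twoColumnLaw p q as b c := by
  induction as generalizing b c with
  | nil => simp [columnLaw, twoColumnLaw]
  | cons a as ih =>
    simp only [columnLaw, twoColumnLaw, PMF.bind_bind, PMF.bind_map]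
    congr 1; funext u
    simp only [Function.comp_def, columnLaw]
    rw [PMF.bind_comm]
    congr 1; funext v
    rw [← ih, PMF.map_bind]

/-- In each row, the induction hypothesis supplies a `g` for the rows below; `exchange` turns it,
with the weights `u` and `v`, into the swapped weights and the `g` for the current row. -/
theorem twoColumnLaw_intertwine {p q r : Set.Ioo (0 : ℝ) 1} (h : (p : ℝ) = q * r)
    (as : List ℕ) (b c : ℕ) :
    twoColumnLaw p q as b c =
      (geometric r).bind fun g => twoColumnLaw q p as (max b (c - g)) c := by
  induction as generalizing b c with
  | nil => simp [twoColumnLaw]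
  | cons a as ih =>
    simp only [twoColumnLaw]
    rw [← bind_exchange h fun u v g =>
      (twoColumnLaw q p as (max (max b (c - g)) a + u) (max c (max (max b (c - g)) a + u) + v)).map
        (List.cons (max c (max (max b (c - g)) a + u) + v))]
    congr 1; funext u
    congr 1; funext v
    rw [ih, PMF.map_bind]
    congr 1; funext g
    -- Pathwise identities: under exchanged weights, the second column is unchanged (`h2`) and the
    -- first has the corrected form (`h1`).
    have h1 : max (max b a + u) (max c (max b a + u) + v - g) =
        max (max b (c - (u + (g - v)))) a + (u + (v - g)) := by omega
    have h2 : max c (max b a + u) + v =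
        max c (max (max b (c - (u + (g - v)))) a + (u + (v - g))) + min v g := by omega
    rw [h1, ← h2]

theorem columnLaw_comm (p q : Set.Ioo (0 : ℝ) 1) (as : List ℕ) :
    ((columnLaw p as 0).bind fun bs => columnLaw q bs 0) =
      (columnLaw q as 0).bind fun bs => columnLaw p bs 0 := by
  have key : ∀ p q : Set.Ioo (0 : ℝ) 1, (p : ℝ) < q →
      twoColumnLaw p q as 0 0 = twoColumnLaw q p as 0 0 := by
    intro p q hpq
    have hr : (p : ℝ) / q ∈ Set.Ioo (0 : ℝ) 1 :=
      ⟨div_pos p.2.1 q.2.1, (div_lt_one q.2.1).2 hpq⟩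
    rw [twoColumnLaw_intertwine (r := ⟨_, hr⟩) (mul_div_cancel₀ _ q.2.1.ne').symm]
    -- Truncated subtraction gives `0 - g = 0`, so the average over `g` is trivial.
    simp
  rw [columnLaw_bind_columnLaw, columnLaw_bind_columnLaw]
  rcases lt_trichotomy (p : ℝ) q with h | h | h
  · exact key p q h
  · rw [Subtype.ext h]
  · exact (key q p h).symm

/-- The law of the passage times in the last of several columns, with parameters `qs`. -/
noncomputable def passageLaw (m : ℕ) (qs : List (Set.Ioo (0 : ℝ) 1)) : PMF (List ℕ) :=
  qs.foldl (fun P q => P.bind fun as => columnLaw q as 0) (PMF.pure (List.replicate m 0))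

theorem passageLaw_perm (m : ℕ) {qs qs' : List (Set.Ioo (0 : ℝ) 1)} (h : qs.Perm qs') :
    passageLaw m qs = passageLaw m qs' := by
  refine h.foldl_eq' (fun p _ q _ P => ?_) _
  simp only [PMF.bind_bind]
  congr 1; funext as
  exact columnLaw_comm _ _ _

/-! ### The recursion for last-passage times -/

theorem IsDirectedPath.le {P : List (ℕ × ℕ)} {a b : ℕ × ℕ} (hP : IsDirectedPath a b P) :
    a.1 ≤ b.1 ∧ a.2 ≤ b.2 := by
  induction P generalizing a with
  | nil => simpa using hP.head
  | cons c l ih =>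
    obtain rfl : c = a := by simpa using hP.head
    cases l with
    | nil =>
      obtain rfl : c = b := by simpa using hP.last
      exact ⟨le_rfl, le_rfl⟩
    | cons d l =>
      have hc := List.isChain_cons_cons.1 hP.chain
      have h3 := ih ⟨hc.2, rfl, by simpa using hP.last⟩
      rcases hc.1 with rfl | rfl <;> simp only at h3 <;> omega

/-- There are no such paths and `sSup ∅ = 0`: this is the boundary value of the recursion. -/
theorem lastPassage_eq_zero (w : ℕ → ℕ → ℕ) {m n : ℕ} (h : m = 0 ∨ n = 0) :
    lastPassage w m n = 0 := by
  have hempty : pathWeights w m n = ∅ := by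
    refine Set.eq_empty_iff_forall_notMem.2 ?_
    rintro s ⟨P, hP, -⟩
    have := hP.le
    simp only at this
    omega
  simp [lastPassage, hempty]

theorem IsDirectedPath.concat {a b c : ℕ × ℕ} {P : List (ℕ × ℕ)} (hP : IsDirectedPath a b P)
    (h : Step b c) : IsDirectedPath a c (P ++ [c]) where
  chain := by
    refine hP.chain.append (by simp) fun x hx y hy => ?_
    have h1 : x = b := by simpa [hP.last, eq_comm] using hx
    have h2 : y = c := by simpa [eq_comm] using hy
    rwa [h1, h2]
  head := by simp [List.head?_append, hP.head]
  last := by simp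

theorem IsDirectedPath.eq_concat {a c : ℕ × ℕ} {P : List (ℕ × ℕ)} (hP : IsDirectedPath a c P) :
    (P = [c] ∧ a = c) ∨ ∃ b P', Step b c ∧ IsDirectedPath a b P' ∧ P = P' ++ [c] := by
  rcases List.eq_nil_or_concat P with rfl | ⟨P', x, rfl⟩
  · simpa using hP.head
  obtain rfl : x = c := by simpa using hP.last
  rcases List.eq_nil_or_concat P' with rfl | ⟨Q, b, rfl⟩
  · left
    simpa [eq_comm] using hP.head
  · refine Or.inr ⟨b, Q ++ [b], ?_, ⟨?_, ?_, by simp⟩, by simp⟩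
    · have h := hP.chain
      simp only [List.concat_eq_append] at h
      exact (List.isChain_append.1 h).2.2 b (by simp) x (by simp)
    · have h := hP.chain
      simp only [List.concat_eq_append] at h
      exact (List.isChain_append.1 h).1
    · simpa [List.head?_append] using hP.head

theorem pathWeight_concat (w : ℕ → ℕ → ℕ) (P : List (ℕ × ℕ)) (c : ℕ × ℕ) :
    pathWeight w (P ++ [c]) = pathWeight w P + w c.1 c.2 := by
  simp [pathWeight]

theorem lastPassage_add_le (w : ℕ → ℕ → ℕ) {m n m' n' : ℕ} (hm' : 1 ≤ m') (hn' : 1 ≤ n')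
    (h : Step (m, n) (m', n')) : lastPassage w m n + w m' n' ≤ lastPassage w m' n' := by
  have hmax := isGreatest_lastPassage w hm' hn'
  by_cases h0 : 1 ≤ m ∧ 1 ≤ n
  · obtain ⟨P, hP, hw⟩ := (isGreatest_lastPassage w h0.1 h0.2).1
    exact hmax.2 ⟨_, hP.concat h, by rw [pathWeight_concat, hw]⟩
  · rw [lastPassage_eq_zero w (by omega), zero_add]
    obtain ⟨P, hP, hw⟩ := hmax.1
    rw [← hw]
    rcases hP.eq_concat with ⟨rfl, -⟩ | ⟨b, P', -, -, rfl⟩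
    · simp [pathWeight]
    · rw [pathWeight_concat]; exact Nat.le_add_left _ _

theorem lastPassage_succ_succ (w : ℕ → ℕ → ℕ) (m n : ℕ) :
    lastPassage w (m + 1) (n + 1) =
      max (lastPassage w m (n + 1)) (lastPassage w (m + 1) n) + w (m + 1) (n + 1) := by
  apply le_antisymm
  · obtain ⟨P, hP, hw⟩ := (isGreatest_lastPassage w (Nat.succ_pos m) (Nat.succ_pos n)).1
    rw [← hw]
    rcases hP.eq_concat with ⟨rfl, -⟩ | ⟨⟨i, j⟩, P', hs, hP', rfl⟩
    · simp [pathWeight]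
    · rw [pathWeight_concat]
      refine Nat.add_le_add_right ?_ _
      have hcoord : (i = m ∧ j = n + 1) ∨ (i = m + 1 ∧ j = n) := by
        rcases hs with h | h <;> simp only [Prod.mk.injEq] at h <;> omega
      have hweight := (isGreatest_lastPassage w hP'.le.1 hP'.le.2).2 ⟨P', hP', rfl⟩
      rcases hcoord with ⟨rfl, rfl⟩ | ⟨rfl, rfl⟩
      · exact hweight.trans (le_max_left _ _)
      · exact hweight.trans (le_max_right _ _)
  · have h1 := lastPassage_add_le w (Nat.succ_pos m) (Nat.succ_pos n) (Or.inl rfl : Step (m, n + 1) _)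
    have h2 := lastPassage_add_le w (Nat.succ_pos m) (Nat.succ_pos n) (Or.inr rfl : Step (m + 1, n) _)
    simp only [Nat.succ_eq_add_one] at h1 h2
    omega

/-- The passage times in a column with weights `w 0, w 1, …`, given the passage times `as` of the
preceding column; `b` is the passage time above the first entry. -/
def columnStep : List ℕ → (ℕ → ℕ) → ℕ → List ℕ
  | [], _, _ => []
  | a :: as, w, b => (max b a + w 0) :: columnStep as (fun i => w (i + 1)) (max b a + w 0)

theorem columnStep_congr (as : List ℕ) {w w' : ℕ → ℕ} (b : ℕ)
    (h : ∀ i < as.length, w i = w' i) : columnStep as w b = columnStep as w' b := by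
  induction as generalizing w w' b with
  | nil => rfl
  | cons a as ih =>
    simp only [columnStep]
    rw [h 0 (by simp), ih _ fun i hi => h (i + 1) (by simpa using hi)]

/-- The list `G(1, n), …, G(m, n)`. -/
noncomputable def passageList (w : ℕ → ℕ → ℕ) (m n : ℕ) : List ℕ :=
  (List.range m).map fun i => lastPassage w (i + 1) n

theorem length_passageList (w : ℕ → ℕ → ℕ) (m n : ℕ) : (passageList w m n).length = m := by
  simp [passageList]

theorem passageList_zero (w : ℕ → ℕ → ℕ) (m : ℕ) : passageList w m 0 = List.replicate m 0 := by
  simp [passageList, lastPassage_eq_zero]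

theorem passageList_succ (w : ℕ → ℕ → ℕ) (m n : ℕ) :
    passageList w m (n + 1) =
      columnStep (passageList w m n) (fun i => w (i + 1) (n + 1)) 0 := by
  -- Induction on the number of rows needs an arbitrary starting row `k`, with `G(k, n + 1)` as the
  -- value above it.
  have key : ∀ m k, (List.range' k m).map (fun i => lastPassage w (i + 1) (n + 1)) =
      columnStep ((List.range' k m).map fun i => lastPassage w (i + 1) n)
        (fun i => w (k + i + 1) (n + 1)) (lastPassage w k (n + 1)) := by
    intro m
    induction m with
    | zero => intro k; rfl
    | succ m ih =>
      intro k
      simp only [List.range'_succ, List.map_cons, columnStep, add_zero]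
      rw [← lastPassage_succ_succ, ih (k + 1)]
      simp only [add_comm, add_left_comm]
  have h := key m 0
  rw [lastPassage_eq_zero w (Or.inl rfl), ← List.range_eq_range'] at h
  simpa [passageList] using h

theorem passageList_congr {w w' : ℕ → ℕ → ℕ} {m n : ℕ}
    (h : ∀ i < m, ∀ j < n, w (i + 1) (j + 1) = w' (i + 1) (j + 1)) :
    passageList w m n = passageList w' m n := by
  induction n with
  | zero => simp only [passageList_zero]
  | succ n ih =>
    rw [passageList_succ, passageList_succ, ih fun i hi j hj => h i hi j (by omega)]
    exact columnStep_congr _ _ fun i hi => h i (by simpa [length_passageList] using hi) n (by omega)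

/-! ### The law of the passage times -/

/-- Conditioning on the discrete value `g (X ω)`; this turns independence into the sum that defines
`PMF.bind`. -/
theorem measure_indepFun_eq_tsum {Ω α β γ : Type*} [MeasurableSpace Ω] {μ : Measure Ω}
    [MeasurableSpace α] [MeasurableSpace β] [Countable α] [Countable β]
    [DiscreteMeasurableSpace α] [DiscreteMeasurableSpace β]
    {X : Ω → α} {Y : Ω → β} (hX : Measurable X) (hY : Measurable Y) (h : IndepFun X Y μ)
    {δ : Type*} [Countable δ] (g : α → δ) (f : δ → β → γ) (c : γ) :
    μ {ω | f (g (X ω)) (Y ω) = c} =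
      ∑' d, μ {ω | g (X ω) = d} * μ {ω | f d (Y ω) = c} := by
  have hu : {ω | f (g (X ω)) (Y ω) = c} =
      ⋃ d, (X ⁻¹' {x | g x = d} ∩ Y ⁻¹' {y | f d y = c}) := by
    ext ω; simp
  rw [hu, measure_iUnion]
  · congr 1; funext d
    exact h.measure_inter_preimage_eq_mul _ _ (.of_discrete) (.of_discrete)
  · intro d d' hd
    refine Set.disjoint_left.2 fun ω h1 h2 => hd ?_
    exact h1.1.symm.trans h2.1
  · exact fun d => (hX .of_discrete).inter (hY .of_discrete)

theorem measure_columnStep {Ω : Type*} [MeasurableSpace Ω] {μ : Measure Ω}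
    [IsProbabilityMeasure μ] (q : Set.Ioo (0 : ℝ) 1) (as : List ℕ) (w : ℕ → Ω → ℕ)
    (hw : ∀ i, Measurable (w i)) (hi : iIndepFun w μ)
    (hl : ∀ i k, μ {ω | w i ω = k} = geometric q k) (b : ℕ) (l : List ℕ) :
    μ {ω | columnStep as (fun i => w i ω) b = l} = columnLaw q as b l := by
  induction as generalizing w b l with
  | nil =>
    by_cases h : l = []
    · simp [columnStep, columnLaw, h]
    · simp [columnStep, columnLaw, h, Ne.symm h]
  | cons a as ih =>
    have ih' := ih (fun i => w (i + 1)) (fun i => hw _) (hi.precomp (add_left_injective 1))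
      (fun i k => hl _ k)
    classical
    let S : Finset ℕ := {0}
    let T : Finset ℕ := Finset.Icc 1 as.length
    have hind := hi.indepFun_finset S T (by simp [S, T]) hw
    -- Only finitely many weights are kept, so that they live in a countable space; the default `0`
    -- is never read.
    let ext : (T → ℕ) → ℕ → ℕ := fun y i => if h : i + 1 ∈ T then y ⟨i + 1, h⟩ else 0
    have hext : ∀ ω b', columnStep as (fun i => w (i + 1) ω) b' =
        columnStep as (ext fun i => w i ω) b' := by
      intro ω b'
      refine columnStep_congr _ _ fun i hi => ?_
      have : i + 1 ∈ T := by simp [T]; omega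
      simp [ext, this]
    have h1 := measure_indepFun_eq_tsum (by fun_prop) (by fun_prop) hind
      (fun x : S → ℕ => x ⟨0, by simp [S]⟩)
      (fun u y => (max b a + u) :: columnStep as (ext y) (max b a + u)) l
    simp only [← hext] at h1
    simp only [columnStep]
    rw [h1, columnLaw, PMF.bind_apply]
    congr 1; funext u
    rw [hl]
    congr 1
    rw [PMF.map_apply]
    cases l with
    | nil => simp
    | cons x l =>
      simp only [List.cons.injEq]
      by_cases hx : x = max b a + u
      · rw [tsum_eq_single l]
        · simp only [hx, true_and, if_true, ← ih']
        · intro l' hl'; simp [hl'.symm]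
      · simp [hx, Ne.symm hx]

/-- Column `n + 1` of weights is independent of the first `n` columns, so each new column applies
one kernel. The index of `Q` is shifted to start at `0`. -/
theorem measure_passageList {Ω : Type*} [MeasurableSpace Ω] {μ : Measure Ω}
    [IsProbabilityMeasure μ] {q : ℕ → ℝ} {W : ℕ → ℕ → Ω → ℕ} (hW : IsGeometricMatrix μ q W)
    (Q : ℕ → Set.Ioo (0 : ℝ) 1) (hQ : ∀ j, (Q j : ℝ) = q (j + 1)) (m n : ℕ) (l : List ℕ) :
    μ {ω | passageList (fun i j => W i j ω) m n = l} =
      passageLaw m ((List.range n).map Q) l := by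
  classical
  induction n generalizing l with
  | zero =>
    by_cases h : l = List.replicate m 0
    · simp [passageList_zero, passageLaw, h]
    · simp [passageList_zero, passageLaw, h, Ne.symm h]
  | succ n ih =>
    let shift : ℕ × ℕ → {p : ℕ × ℕ // 1 ≤ p.1 ∧ 1 ≤ p.2} := fun p => ⟨(p.1 + 1, p.2 + 1), by simp⟩
    have hi := hW.indep.precomp (g := shift)
      (fun p p' h => by simpa [shift, Prod.ext_iff] using h)
    let V : ℕ × ℕ → Ω → ℕ := fun p => W (p.1 + 1) (p.2 + 1)
    have hV : ∀ p, Measurable (V p) := fun p => hW.measurable _ _ (by simp) (by simp)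
    let S : Finset (ℕ × ℕ) := Finset.range m ×ˢ Finset.range n
    let T : Finset (ℕ × ℕ) := Finset.range m ×ˢ {n}
    have hST : Disjoint S T := by
      refine Finset.disjoint_left.2 fun p h1 h2 => ?_
      simp only [S, T, Finset.mem_product, Finset.mem_range, Finset.mem_singleton] at h1 h2
      omega
    have hind : IndepFun (fun ω (p : S) => V p ω) (fun ω (p : T) => V p ω) μ :=
      iIndepFun.indepFun_finset S T hST hi hV
    let extS : (S → ℕ) → ℕ → ℕ → ℕ := fun x i j =>
      if h : (i - 1, j - 1) ∈ S then x ⟨(i - 1, j - 1), h⟩ else 0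
    let extT : (T → ℕ) → ℕ → ℕ := fun y i => if h : (i, n) ∈ T then y ⟨(i, n), h⟩ else 0
    have hS : ∀ ω, passageList (extS fun p => V p ω) m n =
        passageList (fun i j => W i j ω) m n := by
      refine fun ω => passageList_congr fun i hi j hj => ?_
      have : (i, j) ∈ S := by simp [S, hi, hj]
      simp [extS, this, V]
    let f : List ℕ → (T → ℕ) → List ℕ := fun as y =>
      if as.length = m then columnStep as (extT y) 0 else []
    have hT : ∀ ω (as : List ℕ), as.length = m → f as (fun p => V p ω) =
        columnStep as (fun i => W (i + 1) (n + 1) ω) 0 := by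
      intro ω as has
      simp only [f, if_pos has]
      refine columnStep_congr _ _ fun i hi => ?_
      have : (i, n) ∈ T := by simp [T]; omega
      simp [extT, this, V]
    have h1 := measure_indepFun_eq_tsum (by fun_prop) (by fun_prop) hind
      (fun x : S → ℕ => passageList (extS x) m n) f l
    simp only [hS, hT _ _ (length_passageList _ _ _), ← passageList_succ] at h1
    rw [h1, List.range_succ, List.map_append, passageLaw, List.foldl_append]
    simp only [List.map_cons, List.map_nil, List.foldl_cons, List.foldl_nil]
    rw [PMF.bind_apply]
    congr 1; funext as
    by_cases has : as.length = m
    · simp only [hT _ _ has]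
      rw [ih, measure_columnStep (Q n) as (fun i => W (i + 1) (n + 1))]
      · rfl
      · exact fun i => hW.measurable _ _ (by simp) (by simp)
      · exact hi.precomp (g := fun i => (i, n)) (fun i i' h => by simpa using h)
      · intro i k
        rw [hW.law _ _ (by simp) (by simp), geometric_apply, hQ]
    -- Lists of the wrong length have mass zero on both sides.
    · have h0 : {ω | passageList (fun i j => W i j ω) m n = as} = ∅ := by
        refine Set.eq_empty_iff_forall_notMem.2 fun ω h => has ?_
        rw [← (h : _ = as), length_passageList]
      have h2 := ih as
      rw [h0, measure_empty] at h2
      rw [h0, measure_empty, zero_mul]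
      change 0 = passageLaw m ((List.range n).map Q) as * _
      rw [← h2, zero_mul]

theorem measurable_lastPassage {Ω : Type*} [MeasurableSpace Ω] {W : ℕ → ℕ → Ω → ℕ}
    (hW : ∀ i j, 1 ≤ i → 1 ≤ j → Measurable (W i j)) (m n : ℕ) :
    Measurable fun ω => lastPassage (fun i j => W i j ω) m n := by
  induction n generalizing m with
  | zero => simp [lastPassage_eq_zero]
  | succ n ihn =>
    induction m with
    | zero => simp [lastPassage_eq_zero]
    | succ m ihm =>
      simp only [lastPassage_succ_succ]
      exact (ihm.max (ihn _)).add (hW _ _ (by simp) (by simp))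

theorem columnVector_eq_iff {Ω : Type*} (W : ℕ → ℕ → Ω → ℕ) (m n : ℕ) (ω : Ω) (lam : Fin m → ℕ) :
    (∀ k, columnVector W m n ω k = lam k) ↔
      passageList (fun i j => W i j ω) m n = List.ofFn fun i => lam i.rev := by
  have h : passageList (fun i j => W i j ω) m n =
      List.ofFn fun i : Fin m => lastPassage (fun i j => W i j ω) (i + 1) n := by
    simp [passageList, List.ofFn_eq_map, ← List.map_coe_finRange_eq_range]
  rw [h, List.ofFn_inj, funext_iff, ← Fin.revPerm.forall_congr_right]
  refine forall_congr' fun i => ?_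
  have : m - (Fin.rev i : ℕ) = i + 1 := by rw [Fin.val_rev]; omega
  simp only [columnVector, Fin.revPerm_apply, this]

end LastPassage

/-! ### Invariance under permutations of the parameters -/

theorem mainTheorem6 {Ω Ω' : Type*} [MeasurableSpace Ω] [MeasurableSpace Ω']
    (μ : Measure Ω) [IsProbabilityMeasure μ] (μ' : Measure Ω') [IsProbabilityMeasure μ']
    (m n : ℕ) (hm : 1 ≤ m) (hn : 1 ≤ n)
    (q : ℕ → ℝ) (hq : ∀ j, 1 ≤ j → 0 < q j ∧ q j < 1)
    (σ : Equiv.Perm ℕ) (hσ : ∀ j, j ∉ Finset.Icc 1 n → σ j = j)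
    (W : ℕ → ℕ → Ω → ℕ) (hW : LastPassage.IsGeometricMatrix μ q W)
    (W' : ℕ → ℕ → Ω' → ℕ) (hW' : LastPassage.IsGeometricMatrix μ' (fun j => q (σ j)) W') :
    IdentDistrib (LastPassage.columnVector W m n) (LastPassage.columnVector W' m n) μ μ' ∧
      ∀ lam : Fin m → ℕ,
        μ {ω | ∀ k : Fin m, LastPassage.columnVector W m n ω k = lam k} =
          μ' {ω | ∀ k : Fin m, LastPassage.columnVector W' m n ω k = lam k} := by
  have hmap : ∀ j, 1 ≤ j → 1 ≤ σ j := by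
    intro j hj
    by_contra h
    have h0 : σ j = 0 := by omega
    have : j = 0 := σ.injective (h0.trans (hσ 0 (by simp)).symm)
    omega
  let Q : ℕ → Set.Ioo (0 : ℝ) 1 := fun j => ⟨q (j + 1), hq _ (by simp)⟩
  let Q' : ℕ → Set.Ioo (0 : ℝ) 1 := fun j => ⟨q (σ (j + 1)), hq _ (hmap _ (by simp))⟩
  have hperm : ((List.range n).map Q).Perm ((List.range n).map Q') := by
    have h1 : ((List.range n).map fun j => σ (j + 1) - 1).Perm (List.range n) := by
      have hinj : Function.Injective fun j => σ (j + 1) - 1 := by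
        intro i j h
        have hi := hmap (i + 1) (by simp)
        have hj := hmap (j + 1) (by simp)
        have : σ (i + 1) = σ (j + 1) := by simp only at h; omega
        simpa using σ.injective this
      refine (List.subperm_of_subset (List.nodup_range.map hinj) ?_).perm_of_length_le (by simp)
      intro x hx
      obtain ⟨j, hj, rfl⟩ := List.mem_map.1 hx
      rw [List.mem_range] at hj ⊢
      have hj1 := hmap (j + 1) (by simp)
      by_contra h
      -- A value `σ (j + 1)` outside `1, …, n` would be fixed by `σ`, forcing `σ (j + 1) = j + 1`,
      -- which lies inside.
      have h2 := σ.injective (hσ (σ (j + 1)) (by simp only [Finset.mem_Icc]; omega))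
      omega
    have h2 := (h1.map Q).symm
    rw [List.map_map] at h2
    convert h2 using 2
    funext j
    simp only [Q, Q', Function.comp_apply, Nat.sub_add_cancel (hmap (j + 1) (by simp))]
  have hlaw : ∀ lam : Fin m → ℕ,
      μ {ω | ∀ k : Fin m, LastPassage.columnVector W m n ω k = lam k} =
        μ' {ω | ∀ k : Fin m, LastPassage.columnVector W' m n ω k = lam k} := by
    intro lam
    simp only [LastPassage.columnVector_eq_iff]
    rw [LastPassage.measure_passageList hW Q fun _ => rfl,
      LastPassage.measure_passageList hW' Q' fun _ => rfl, LastPassage.passageLaw_perm m hperm]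
  have hmeas : Measurable (LastPassage.columnVector W m n) :=
    measurable_pi_lambda _ fun k => LastPassage.measurable_lastPassage hW.measurable _ _
  have hmeas' : Measurable (LastPassage.columnVector W' m n) :=
    measurable_pi_lambda _ fun k => LastPassage.measurable_lastPassage hW'.measurable _ _
  -- The target `Fin m → ℕ` is countable, so point masses determine the law.
  refine ⟨⟨hmeas.aemeasurable, hmeas'.aemeasurable, Measure.ext_of_singleton fun lam => ?_⟩, hlaw⟩
  rw [Measure.map_apply hmeas (measurableSet_singleton _),
    Measure.map_apply hmeas' (measurableSet_singleton _)]
  simpa only [Set.preimage, Set.mem_singleton_iff, funext_iff] using hlaw lam
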